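/- An ideal of an integral domain $D$ is called an MNI ideal if it is maximal (with respect to inclusion) among the non-invertible ideals of $D$ (the zero ideal counts as non-invertible). A domain $D$ is an MPD domain if it has a unique MNI ideal $Q$ and every nonzero non-invertible ideal of $D$ is of the form $JQ$ for some invertible ideal $J$ of $D$. A domain $D$ is $h$-local if every nonzero ideal is contained in only finitely many maximal ideals and every nonzero prime ideal is contained in a unique maximal ideal. A domain $D$ is a GMPD domain if it is $h$-local and $D_M$ is an MPD domain for every maximal ideal $M$ of $D$. **Proposition.** Let $n$ be a natural number. Up to isomorphism of partially ordered sets, at most $\lceil n/2\rceil$ partially ordered sets occur as $\operatorname{Spec}(D)$, ordered by inclusion, for a GMPD domain $D$ with $|\operatorname{Spec}(D)| = n$. That is, if $(D_i)_{i\in I}$ is a family of GMPD domains with $|\operatorname{Spec}(D_i)| = n$ for all $i$ and such that $\operatorname{Spec}(D_i)\not\cong\operatorname{Spec}(D_j)$ as partially ordered sets whenever $i\neq j$, then $|I|\le\lceil n/2\rceil$. -/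

import Mathlib

open scoped nonZeroDivisors

/-- An ideal `I` of an integral domain `R` is invertible if `I * I' = R` for some fractional ideal
`I'` of `R`, i.e. if it is a unit among the fractional ideals of `R` in its quotient field. -/
def IsInvertibleIdeal {R : Type*} [CommRing R] (I : Ideal R) : Prop :=
  IsUnit (I : FractionalIdeal R⁰ (FractionRing R))

/-- An MNI ideal: maximal among the non-invertible ideals (the zero ideal is allowed). -/
def IsMNI {R : Type*} [CommRing R] (Q : Ideal R) : Prop :=
  Maximal (fun I : Ideal R => ¬ IsInvertibleIdeal I) Q

/-- Multiplicatively pinched-Dedekind (MPD) domain: there is a unique MNI ideal `Q`, and every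
nonzero non-invertible ideal is `J * Q` for some invertible ideal `J`. -/
structure IsMPD (R : Type*) [CommRing R] : Prop where
  isDomain : IsDomain R
  exists_factor : ∃ Q : Ideal R, IsMNI Q ∧ (∀ Q' : Ideal R, IsMNI Q' → Q' = Q) ∧
    ∀ I : Ideal R, I ≠ ⊥ → ¬ IsInvertibleIdeal I → ∃ J : Ideal R, IsInvertibleIdeal J ∧ I = J * Q

/-- `h`-local domain: every nonzero ideal lies in only finitely many maximal ideals, and every
nonzero prime ideal lies in a unique maximal ideal. -/
structure IsHLocal (R : Type*) [CommRing R] : Prop where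
  isDomain : IsDomain R
  finite_maximal : ∀ I : Ideal R, I ≠ ⊥ → {M : Ideal R | M.IsMaximal ∧ I ≤ M}.Finite
  unique_maximal : ∀ P : Ideal R, P.IsPrime → P ≠ ⊥ → ∃! M : Ideal R, M.IsMaximal ∧ P ≤ M

/-- Globalized multiplicatively pinched-Dedekind (GMPD) domain: an `h`-local domain all of whose
localizations at maximal ideals are MPD domains. -/
structure IsGMPD (R : Type*) [CommRing R] : Prop where
  isHLocal : IsHLocal R
  isMPD_localization : ∀ (M : Ideal R) [M.IsMaximal], IsMPD (Localization.AtPrime M)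

/-! Away from zero, the spectrum is a disjoint union of chains of one or two primes. By `h`-locality
each nonzero prime lies under one maximal ideal. In a local MPD domain every nonzero nonmaximal
prime `P` is the MNI ideal `Q`: if `P` is not invertible, `P = J * Q` and primality give `P = Q`; if
it is, `P = (p)` with `p` prime, and such a `p` divides every nonunit, so `P` is maximal after all.
Such a poset is determined by `n` and the number `k` of two-element chains. Since `1 + 2k ≤ n`,
there are at most `⌈n/2⌉` values of `k`. -/

/-- The nonzero nonmaximal elements of a poset with a least element. -/
abbrev MiddleElement (P : Type*) [PartialOrder P] [OrderBot P] := {x : P // x ≠ ⊥ ∧ ¬ IsMax x}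

/-- The maximal elements, other than the least one, of a poset with a least element. -/
abbrev TopElement (P : Type*) [PartialOrder P] [OrderBot P] := {x : P // x ≠ ⊥ ∧ IsMax x}

/-- A poset with a least element `⊥` such that, away from `⊥`, it is a disjoint union of chains
with a greatest element and at most one further element. -/
structure HasShortBranches (P : Type*) [PartialOrder P] [OrderBot P] : Prop where
  existsUnique_isMax : ∀ x : P, x ≠ ⊥ → ∃! m, IsMax m ∧ x ≤ m
  eq_of_lt : ∀ m : P, IsMax m → ∀ x y : P, x ≠ ⊥ → y ≠ ⊥ → x < m → y < m → x = y

namespace HasShortBranches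

variable {P P' : Type*} [PartialOrder P] [OrderBot P] [PartialOrder P'] [OrderBot P']

/-- Encodes the order away from `⊥` in a single injection, middle element to the maximal element
above it. -/
lemma exists_topElement (h : HasShortBranches P) :
    ∃ μ : MiddleElement P → TopElement P, Function.Injective μ ∧
      ∀ (x : MiddleElement P) (y : P), x.1 ≤ y ↔ y = x.1 ∨ y = (μ x).1 := by
  choose μ hμ using fun x : MiddleElement P => (h.existsUnique_isMax x.1 x.2.1).exists
  have hlt : ∀ x, x.1 < μ x := fun x =>
    lt_of_le_of_ne (hμ x).2 fun he => x.2.2 (he ▸ (hμ x).1)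
  refine ⟨fun x => ⟨μ x, (bot_le.trans_lt (hlt x)).ne', (hμ x).1⟩, ?_, ?_⟩
  · intro x y hxy
    have hxy : μ x = μ y := congrArg Subtype.val hxy
    exact Subtype.ext (h.eq_of_lt _ (hμ x).1 _ _ x.2.1 y.2.1 (hlt x) (hxy ▸ hlt y))
  · intro x y
    refine ⟨fun hxy => ?_, ?_⟩
    · have hy : y ≠ ⊥ := fun hy => x.2.1 (le_bot_iff.1 (hy ▸ hxy))
      by_cases hmax : IsMax y
      · exact .inr ((h.existsUnique_isMax x.1 x.2.1).unique ⟨hmax, hxy⟩ (hμ x))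
      · left
        have hxy' : μ x = μ ⟨y, hy, hmax⟩ :=
          (h.existsUnique_isMax x.1 x.2.1).unique (hμ x)
            ⟨(hμ ⟨y, hy, hmax⟩).1, hxy.trans (hμ ⟨y, hy, hmax⟩).2⟩
        exact h.eq_of_lt _ (hμ x).1 _ _ hy x.2.1 (hxy' ▸ hlt ⟨y, hy, hmax⟩) (hlt x)
    · rintro (rfl | rfl)
      exacts [le_rfl, (hμ x).2]

end HasShortBranches

lemma natCard_eq_one_add_middleElement_add_topElement (P : Type*) [PartialOrder P] [OrderBot P]
    [Finite P] : Nat.card P = 1 + Nat.card (MiddleElement P) + Nat.card (TopElement P) := by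
  classical
  have := Fintype.ofFinite P
  rw [Nat.card_eq_fintype_card, Nat.card_eq_fintype_card, Nat.card_eq_fintype_card,
    Fintype.card_subtype, Fintype.card_subtype, ← Finset.card_univ, add_assoc,
    ← Finset.card_union_of_disjoint, ← Finset.card_singleton (⊥ : P),
    ← Finset.card_union_of_disjoint]
  · congr 1
    ext x
    simp only [Finset.mem_univ, Finset.mem_union, Finset.mem_singleton, Finset.mem_filter]
    tauto
  · simp
  · rw [Finset.disjoint_filter]
    tauto

namespace HasShortBranches

variable {P P' : Type*} [PartialOrder P] [OrderBot P] [PartialOrder P'] [OrderBot P']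

/-- Each middle element has its own top element. Strictness comes from `⊥`, and for even `n` it
saves one value of `k`. -/
lemma two_mul_natCard_middleElement_lt [Finite P] (h : HasShortBranches P) :
    2 * Nat.card (MiddleElement P) < Nat.card P := by
  obtain ⟨μ, hμ, -⟩ := h.exists_topElement
  have := Nat.card_le_card_of_injective μ hμ
  rw [natCard_eq_one_add_middleElement_add_topElement P]
  omega

/-- A finite poset with short branches is determined up to isomorphism by its cardinality and its
number of middle elements. -/
theorem nonempty_orderIso [Finite P] [Finite P'] (h : HasShortBranches P)
    (h' : HasShortBranches P') (hcard : Nat.card P = Nat.card P')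
    (hmid : Nat.card (MiddleElement P) = Nat.card (MiddleElement P')) : Nonempty (P ≃o P') := by
  classical
  obtain ⟨μ, hμ, hle⟩ := h.exists_topElement
  obtain ⟨μ', hμ', hle'⟩ := h'.exists_topElement
  have htop : Nat.card (TopElement P) = Nat.card (TopElement P') := by
    rw [natCard_eq_one_add_middleElement_add_topElement P,
      natCard_eq_one_add_middleElement_add_topElement P'] at hcard
    omega
  let eB : MiddleElement P ≃ MiddleElement P' := (Finite.card_eq.1 hmid).some
  let e₀ : TopElement P ≃ TopElement P' := (Finite.card_eq.1 htop).some
  -- An arbitrary `e₀` need not respect the chains; `σ` corrects it so that tops of two-element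
  -- chains match along `eB`.
  obtain ⟨σ, hσ⟩ := Equiv.Perm.exists_extending_pair (e₀ ∘ μ) (μ' ∘ eB)
    (e₀.injective.comp hμ) (hμ'.comp eB.injective)
  let eT : TopElement P ≃ TopElement P' := e₀.trans σ
  have heT : ∀ x, eT (μ x) = μ' (eB x) := hσ
  let F : P → P' := fun x =>
    if h0 : x = ⊥ then ⊥ else
    if h1 : IsMax x then (eT ⟨x, h0, h1⟩).1 else (eB ⟨x, h0, h1⟩).1
  have Fbot : F ⊥ = ⊥ := by simp [F]
  have FT : ∀ t : TopElement P, F t.1 = (eT t).1 := fun t => by simp [F, t.2.1, t.2.2]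
  have FB : ∀ b : MiddleElement P, F b.1 = (eB b).1 := fun b => by simp [F, b.2.1, b.2.2]
  have cases : ∀ x : P, x = ⊥ ∨ (∃ t : TopElement P, x = t.1) ∨ ∃ b : MiddleElement P, x = b.1 := by
    intro x
    by_cases h0 : x = ⊥
    · exact .inl h0
    by_cases h1 : IsMax x
    · exact .inr (.inl ⟨⟨x, h0, h1⟩, rfl⟩)
    · exact .inr (.inr ⟨⟨x, h0, h1⟩, rfl⟩)
  have Fne : ∀ x, x ≠ ⊥ → F x ≠ ⊥ := by
    intro x hx
    obtain rfl | ⟨t, rfl⟩ | ⟨b, rfl⟩ := cases x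
    · exact absurd rfl hx
    · rw [FT]; exact (eT t).2.1
    · rw [FB]; exact (eB b).2.1
  have Finj : Function.Injective F := by
    intro x y hxy
    by_cases hx : x = ⊥
    · by_contra hne
      exact Fne y (fun hy => hne (hx.trans hy.symm)) (by rw [← hxy, hx, Fbot])
    by_cases hy : y = ⊥
    · exact absurd (by rw [hxy, hy, Fbot]) (Fne x hx)
    obtain h0 | ⟨s, rfl⟩ | ⟨b, rfl⟩ := cases x
    · exact absurd h0 hx
    · obtain h0 | ⟨t, rfl⟩ | ⟨c, rfl⟩ := cases y
      · exact absurd h0 hy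
      · rw [FT, FT] at hxy
        rw [eT.injective (Subtype.ext hxy)]
      · rw [FT, FB] at hxy
        exact absurd (hxy ▸ (eT s).2.2) (eB c).2.2
    · obtain h0 | ⟨t, rfl⟩ | ⟨c, rfl⟩ := cases y
      · exact absurd h0 hy
      · rw [FB, FT] at hxy
        exact absurd (hxy ▸ (eT t).2.2) (eB b).2.2
      · rw [FB, FB] at hxy
        rw [eB.injective (Subtype.ext hxy)]
  have Fle : ∀ x y, F x ≤ F y ↔ x ≤ y := by
    intro x y
    obtain rfl | ⟨t, rfl⟩ | ⟨b, rfl⟩ := cases x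
    · simp [Fbot]
    · refine ⟨fun hxy => ?_, fun hxy => ?_⟩
      · exact (Finj ((FT t ▸ (eT t).2.2 : IsMax (F t.1)).eq_of_le hxy)).le
      · rw [t.2.2.eq_of_le hxy]
    · rw [hle b y, FB, hle' (eB b), ← heT, ← FB, ← FT, Finj.eq_iff, Finj.eq_iff]
  have Fsurj : Function.Surjective F :=
    ((Nat.bijective_iff_injective_and_card F).2 ⟨Finj, hcard⟩).2
  exact ⟨RelIso.ofSurjective (OrderEmbedding.ofMapLEIff F Fle) Fsurj⟩

end HasShortBranches

/-! ### Primes of local MPD domains -/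

lemma IsInvertibleIdeal.eq_top_of_eq_mul {R : Type*} [CommRing R] {J Q : Ideal R}
    (hJ : IsInvertibleIdeal J) (h : J = J * Q) : Q = ⊤ := by
  have h' : (J : FractionalIdeal (nonZeroDivisors R) (FractionRing R)) * 1 = J * Q := by
    rw [mul_one, ← FractionalIdeal.coeIdeal_mul, ← h]
  have := hJ.mul_left_cancel h'
  rw [← FractionalIdeal.coeIdeal_top] at this
  exact (FractionalIdeal.coeIdeal_injective' le_rfl this).symm

lemma isInvertibleIdeal_top {R : Type*} [CommRing R] : IsInvertibleIdeal (⊤ : Ideal R) := by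
  rw [IsInvertibleIdeal, FractionalIdeal.coeIdeal_top]
  exact isUnit_one

lemma IsInvertibleIdeal.exists_eq_span_singleton {R : Type*} [CommRing R] [IsLocalRing R]
    {I : Ideal R} (hI : IsInvertibleIdeal I) : ∃ x, I = Ideal.span {x} := by
  have hfin : {I : Ideal R | I.IsMaximal}.Finite :=
    (Set.finite_singleton (IsLocalRing.maximalIdeal R)).subset
      fun _ h => IsLocalRing.eq_maximalIdeal h
  exact (Ideal.IsPrincipal.of_finite_maximals_of_isUnit hfin hI).principal

/-- In a local domain, a prime element `p` and a nonunit `m` not divisible by `p` never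
generate an invertible ideal. -/
lemma not_isInvertibleIdeal_span_pair {R : Type*} [CommRing R] [IsDomain R]
    [IsLocalRing R] {p m : R} (hp : Prime p) (hm : m ∈ IsLocalRing.maximalIdeal R)
    (hpm : ¬ p ∣ m) : ¬ IsInvertibleIdeal (Ideal.span {p, m}) := by
  intro hI
  obtain ⟨c, hc⟩ := hI.exists_eq_span_singleton
  have hcp : c ∣ p := Ideal.mem_span_singleton.1 (hc ▸ Ideal.subset_span (by simp))
  have hcm : c ∣ m := Ideal.mem_span_singleton.1 (hc ▸ Ideal.subset_span (by simp))
  obtain ⟨u, rfl⟩ := hcp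
  rcases hp.irreducible.isUnit_or_isUnit rfl with h | h
  · have htop : Ideal.span {c * u, m} = ⊤ := by rw [hc, Ideal.span_singleton_eq_top]; exact h
    refine IsLocalRing.maximalIdeal.isMaximal R |>.ne_top (top_le_iff.1 ?_)
    rw [← htop, Ideal.span_le]
    rintro x (rfl | rfl)
    exacts [(IsLocalRing.mem_maximalIdeal _).2 hp.not_isUnit, hm]
  · exact hpm ((h.mul_right_dvd).2 hcm)

/-- Primality gives `J ≤ P` or `Q ≤ P`. The former forces `J = J * Q`, and cancelling `J` makes `Q`
the unit ideal. -/
lemma Ideal.eq_of_isPrime_of_eq_mul {R : Type*} [CommRing R] {P J Q : Ideal R} (hP : P.IsPrime)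
    (hJ : IsInvertibleIdeal J) (hQ : ¬ IsInvertibleIdeal Q) (h : P = J * Q) : P = Q := by
  rcases hP.mul_le.1 h.ge with hJP | hQP
  · have : J = J * Q := le_antisymm (hJP.trans h.le) Ideal.mul_le_left
    exact absurd (hJ.eq_top_of_eq_mul this ▸ isInvertibleIdeal_top) hQ
  · exact le_antisymm (h.le.trans Ideal.mul_le_right) hQP

/-- A nonzero prime element of a local MPD domain generates the maximal ideal. -/
lemma IsMPD.dvd_of_mem_maximalIdeal {R : Type*} [CommRing R] [IsLocalRing R] (hR : IsMPD R)
    {p : R} (hp : Prime p) {m : R} (hm : m ∈ IsLocalRing.maximalIdeal R) : p ∣ m := by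
  have := hR.isDomain
  obtain ⟨Q, -, -, hfac⟩ := hR.exists_factor
  have key : ∀ m ∈ IsLocalRing.maximalIdeal R, ¬ p ∣ m → Ideal.span {p, m} = Q := by
    intro m hm hpm
    have hne : Ideal.span {p, m} ≠ ⊥ := fun h =>
      hp.ne_zero (Ideal.mem_bot.1 (h ▸ Ideal.subset_span (by simp)))
    obtain ⟨J, hJ, hJQ⟩ :=
      hfac _ hne (not_isInvertibleIdeal_span_pair hp hm hpm)
    obtain ⟨x, rfl⟩ := hJ.exists_eq_span_singleton
    have hpI : p ∈ Ideal.span {x} * Q := hJQ ▸ Ideal.subset_span (by simp)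
    obtain ⟨q, -, hxq⟩ := Ideal.mem_span_singleton_mul.1 hpI
    -- If `q` were a unit, `x` would be associated to `p`, and `p` would divide all of `(x) * Q`,
    -- including `m`.
    have hx : IsUnit x := by
      refine (hp.irreducible.isUnit_or_isUnit hxq.symm).resolve_right fun hq => hpm ?_
      have hmI : m ∈ Ideal.span {x} * Q := hJQ ▸ Ideal.subset_span (by simp)
      obtain ⟨r, -, rfl⟩ := Ideal.mem_span_singleton_mul.1 hmI
      rw [← hxq, hq.mul_right_dvd]
      exact dvd_mul_right _ _
    rw [hJQ, Ideal.span_singleton_eq_top.2 hx, Ideal.top_mul]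
  by_contra hpm
  -- Both `(p, m)` and `(p, m²)` equal `Q`, so `m = a * p + b * m²`; as `1 - m * b` is a unit, `p ∣
  -- m`.
  have h2 : m ∈ Ideal.span {p, m * m} := by
    rw [key _ (Ideal.mul_mem_left _ m hm) fun h => (hp.dvd_or_dvd h).elim hpm hpm,
      ← key m hm hpm]
    exact Ideal.subset_span (by simp)
  obtain ⟨a, b, hab⟩ := Ideal.mem_span_pair.1 h2
  have hunit : IsUnit (1 - m * b) :=
    IsLocalRing.isUnit_one_sub_self_of_mem_nonunits _
      ((IsLocalRing.mem_maximalIdeal _).1 (Ideal.mul_mem_right b _ hm))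
  exact hpm (hunit.dvd_mul_right.1 ⟨a, by linear_combination -hab⟩)

/-- A local MPD domain has at most one nonzero nonmaximal prime ideal. -/
theorem IsMPD.eq_of_isPrime_of_not_isMaximal {R : Type*} [CommRing R] [IsLocalRing R]
    (hR : IsMPD R) {P P' : Ideal R} (hP : P.IsPrime) (hP' : P'.IsPrime) (h0 : P ≠ ⊥)
    (h0' : P' ≠ ⊥) (hmax : ¬ P.IsMaximal) (hmax' : ¬ P'.IsMaximal) : P = P' := by
  obtain ⟨Q, hQ, -, hfac⟩ := hR.exists_factor
  have key : ∀ P : Ideal R, P.IsPrime → P ≠ ⊥ → ¬ P.IsMaximal → P = Q := by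
    intro P hP h0 hmax
    by_cases hinv : IsInvertibleIdeal P
    · obtain ⟨p, rfl⟩ := hinv.exists_eq_span_singleton
      have hp0 : p ≠ 0 := fun h => h0 (Ideal.span_singleton_eq_bot.2 h)
      have hp : Prime p := (Ideal.span_singleton_prime hp0).1 hP
      refine absurd ?_ hmax
      have : Ideal.span {p} = IsLocalRing.maximalIdeal R :=
        le_antisymm (IsLocalRing.le_maximalIdeal hP.ne_top) fun m hm =>
          Ideal.mem_span_singleton.2 (hR.dvd_of_mem_maximalIdeal hp hm)
      exact this ▸ IsLocalRing.maximalIdeal.isMaximal R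
    · obtain ⟨J, hJ, h⟩ := hfac P h0 hinv
      exact Ideal.eq_of_isPrime_of_eq_mul hP hJ hQ.prop h
  rw [key P hP h0 hmax, key P' hP' h0' hmax']

/-! ### Spectra of GMPD domains -/

lemma PrimeSpectrum.isMax_iff_isMaximal {R : Type*} [CommRing R] (x : PrimeSpectrum R) :
    IsMax x ↔ x.asIdeal.IsMaximal := by
  refine ⟨fun h => ?_, fun h y hxy => ?_⟩
  · obtain ⟨M, hM, hle⟩ := x.asIdeal.exists_le_maximal x.2.ne_top
    have : x = ⟨M, hM.isPrime⟩ := h.eq_of_le hle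
    rw [this]
    exact hM
  · exact (h.eq_of_le y.2.ne_top hxy).ge

/-- Primes inside `M` correspond in order to primes of the localization; comparing with `⊥` and `M`
keeps them nonzero and nonmaximal there. -/
lemma IsGMPD.eq_of_lt_isMaximal {R : Type*} [CommRing R] (hR : IsGMPD R) {M P P' : Ideal R}
    (hM : M.IsMaximal) (hP : P.IsPrime) (hP' : P'.IsPrime) (h0 : P ≠ ⊥) (h0' : P' ≠ ⊥)
    (hlt : P < M) (hlt' : P' < M) : P = P' := by
  have := hR.isHLocal.isDomain
  have hloc := hR.isMPD_localization M
  have := hloc.isDomain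
  let e := IsLocalization.AtPrime.orderIsoOfPrime (Localization.AtPrime M) M
  have hbot : ∀ x, x.1 ≠ ⊥ → (e.symm x).1 ≠ ⊥ := fun x hx hex => hx <| by
    let z : {p : Ideal R // p.IsPrime ∧ p ≤ M} := ⟨⊥, Ideal.isPrime_bot, bot_le⟩
    have h1 : (e.symm x).1 ≤ (e.symm z).1 := hex ▸ bot_le
    have h2 : x ≤ z := e.symm.le_iff_le.1 h1
    exact le_bot_iff.1 h2
  have hmax : ∀ x, x.1 < M → ¬ (e.symm x).1.IsMaximal := fun x hx hex => by
    let z : {p : Ideal R // p.IsPrime ∧ p ≤ M} := ⟨M, hM.isPrime, le_rfl⟩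
    have hxz : x < z := hx
    have h1 : (e.symm x).1 < (e.symm z).1 := e.symm.lt_iff_lt.2 hxz
    exact (e.symm z).2.ne_top (hex.1.2 _ h1)
  have := hloc.eq_of_isPrime_of_not_isMaximal (e.symm ⟨P, hP, hlt.le⟩).2
    (e.symm ⟨P', hP', hlt'.le⟩).2 (hbot _ h0) (hbot _ h0') (hmax _ hlt) (hmax _ hlt')
  exact congrArg Subtype.val (e.symm.injective (Subtype.ext this))

lemma PrimeSpectrum.asIdeal_ne_bot {R : Type*} [CommRing R] [IsDomain R] {x : PrimeSpectrum R}
    (hx : x ≠ ⊥) : x.asIdeal ≠ ⊥ :=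
  fun h => hx (PrimeSpectrum.ext h)

theorem IsGMPD.hasShortBranches {R : Type*} [CommRing R] [IsDomain R] (hR : IsGMPD R) :
    HasShortBranches (PrimeSpectrum R) where
  existsUnique_isMax x hx := by
    obtain ⟨M, ⟨hM, hle⟩, huniq⟩ :=
      hR.isHLocal.unique_maximal x.asIdeal x.2 (PrimeSpectrum.asIdeal_ne_bot hx)
    refine ⟨⟨M, hM.isPrime⟩, ⟨(PrimeSpectrum.isMax_iff_isMaximal _).2 hM, hle⟩, ?_⟩
    rintro y ⟨hy, hxy⟩
    exact PrimeSpectrum.ext (huniq _ ⟨(PrimeSpectrum.isMax_iff_isMaximal _).1 hy, hxy⟩)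
  eq_of_lt m hm x y hx hy hxm hym :=
    PrimeSpectrum.ext <| hR.eq_of_lt_isMaximal ((PrimeSpectrum.isMax_iff_isMaximal _).1 hm)
      x.2 y.2 (PrimeSpectrum.asIdeal_ne_bot hx) (PrimeSpectrum.asIdeal_ne_bot hy) hxm hym

theorem proposition2p10 {ι : Type*} (n : ℕ) (D : ι → Type*) [∀ i, CommRing (D i)]
    (hD : ∀ i, IsGMPD (D i))
    (hn : ∀ i, ENat.card (PrimeSpectrum (D i)) = (n : ℕ∞))
    (hne : Pairwise fun i j => IsEmpty (PrimeSpectrum (D i) ≃o PrimeSpectrum (D j))) :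
    ENat.card ι ≤ ((⌈(n : ℚ) / 2⌉₊ : ℕ) : ℕ∞) := by
  have hdom : ∀ i, IsDomain (D i) := fun i => (hD i).isHLocal.isDomain
  have hfin : ∀ i, Finite (PrimeSpectrum (D i)) := fun i =>
    ENat.card_lt_top.1 (hn i ▸ ENat.natCast_lt_top n)
  have hcard : ∀ i, Nat.card (PrimeSpectrum (D i)) = n := fun i => by
    rw [Nat.card, ← ENat.toNat_natCast n, ← hn i]
    rfl
  have hlt : ∀ i, Nat.card (MiddleElement (PrimeSpectrum (D i))) < ⌈(n : ℚ) / 2⌉₊ := fun i => by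
    have h := (hD i).hasShortBranches.two_mul_natCard_middleElement_lt
    rw [hcard i] at h
    have h' : (2 : ℚ) * Nat.card (MiddleElement (PrimeSpectrum (D i))) < n := by exact_mod_cast h
    rw [Nat.lt_ceil]
    linarith
  let f : ι → Fin ⌈(n : ℚ) / 2⌉₊ := fun i => ⟨_, hlt i⟩
  have hf : Function.Injective f := fun i j hij => by
    by_contra hne'
    obtain ⟨e⟩ := (hD i).hasShortBranches.nonempty_orderIso (hD j).hasShortBranches
      ((hcard i).trans (hcard j).symm) (Fin.val_eq_of_eq hij)
    exact (hne hne').false e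
  calc ENat.card ι ≤ ENat.card (Fin ⌈(n : ℚ) / 2⌉₊) := ENat.card_le_card_of_injective hf
    _ = _ := by simp
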